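/- All graphs are finite and simple. A tree-decomposition of a graph $G$ is a pair $(T,(B_x)_{x\in V(T)})$, where $T$ is a non-null finite tree and each $B_x\subseteq V(G)$, such that every edge of $G$ has both its ends in some $B_x$, and for every $v\in V(G)$ the set $\{x\in V(T): v\in B_x\}$ induces a non-empty connected subtree of $T$. Its width is $\max_x|B_x|-1$, and the treewidth $\operatorname{tw}(G)$ is the minimum width of a tree-decomposition of $G$. A tree-decomposition is $k$-simple if it has width at most $k$ and every set $S$ of $k$ vertices of $G$ satisfies $|\{x\in V(T): S\subseteq B_x\}|\le 2$. The simple treewidth of $G$ is the minimum $k\in\mathbb{N}=\{0,1,2,\dots\}$ such that $G$ has a $k$-simple tree-decomposition. A finite digraph $\vec H$ is oriented if $\overrightarrow{uv}\in E(\vec H)$ implies $\overrightarrow{vu}\notin E(\vec H)$. Its underlying graph $H$ has the same vertices, with two distinct vertices adjacent if there is an arc between them in at least one direction, and $\Delta^-(\vec H)$ is its maximum indegree. For digraphs $\vec H_1,\vec H_2$, let the directed product graph $\vec H_1\oslash\vec H_2$ be the underlying undirected graph of the digraph with vertex set $V(H_1)\times V(H_2)$ that has an arc from $(x,y)$ to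 $(x',y')$ if and only if $x=x'$ and $\overrightarrow{yy'}\in E(\vec H_2)$, or $y=y'$ and $\overrightarrow{xx'}\in E(\vec H_1)$, or $\overrightarrow{xx'}\in E(\vec H_1)$ and $\overrightarrow{yy'}\in E(\vec H_2)$. **Theorem 1.8.** For every integer $k\ge 2$, every graph of simple treewidth at most $k$ (in particular, every graph of simple treewidth exactly $k$) is isomorphic to a subgraph of $\vec H_1\oslash\vec H_2$ for some finite oriented digraphs $\vec H_1$ and $\vec H_2$ with $\operatorname{tw}(H_1),\operatorname{tw}(H_2)\le k-1$ and $\Delta^-(\vec H_1),\Delta^-(\vec H_2)\le k-1$. -/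

import Mathlib

universe u

namespace SimpleGraph

/-- A tree-decomposition of a graph, indexed by the nodes of a finite (non-null) tree. The bags are
finite sets of vertices. -/
structure TreeDecomposition {V : Type u} (G : SimpleGraph V) where
  Node : Type
  finite_node : Finite Node
  tree : SimpleGraph Node
  isTree : tree.IsTree
  bag : Node → Finset V
  /-- Both ends of each edge lie in a common bag. -/
  exists_bag_of_adj : ∀ v w : V, G.Adj v w → ∃ x : Node, v ∈ bag x ∧ w ∈ bag x
  /-- The nodes whose bags contain a given vertex induce a non-empty subtree. -/
  connected : ∀ v : V, (tree.induce {x : Node | v ∈ bag x}).Connected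

namespace TreeDecomposition

variable {V : Type u} {G : SimpleGraph V}

/-- The width of a tree-decomposition: the maximum size of a bag, minus one (an integer, so that
the width is `-1` if all bags are empty). -/
noncomputable def width (D : TreeDecomposition G) : ℤ :=
  ((⨆ x : D.Node, (D.bag x).card : ℕ) : ℤ) - 1

/-- A tree-decomposition is `k`-simple if it has width at most `k` and every set of `k` vertices is
contained in at most two bags (bags are counted by nodes). -/
def IsSimple (D : TreeDecomposition G) (k : ℕ) : Prop :=
  D.width ≤ (k : ℤ) ∧
    ∀ S : Finset V, S.card = k → {x : D.Node | S ⊆ D.bag x}.ncard ≤ 2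

theorem width_le_iff (D : TreeDecomposition G) (w : ℤ) :
    D.width ≤ w ↔ ∀ x : D.Node, ((D.bag x).card : ℤ) - 1 ≤ w := by
  have := D.finite_node
  have : Nonempty D.Node := D.isTree.connected.nonempty
  constructor
  · intro h x
    have hx : (D.bag x).card ≤ ⨆ x : D.Node, (D.bag x).card :=
      le_ciSup (f := fun x : D.Node => (D.bag x).card) (Set.finite_range _).bddAbove x
    unfold width at h
    omega
  · intro h
    obtain ⟨x, hx⟩ := exists_eq_ciSup_of_finite (f := fun x : D.Node => (D.bag x).card)
    have := h x
    unfold width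
    rw [← hx]
    exact this

theorem neg_one_le_width (D : TreeDecomposition G) : -1 ≤ D.width := by
  unfold width
  omega

/-- The decomposition of a finite graph with a single bag. -/
def trivial [Fintype V] (G : SimpleGraph V) : TreeDecomposition G where
  Node := Unit
  finite_node := inferInstance
  tree := ⊥
  isTree := .of_subsingleton
  bag _ := Finset.univ
  exists_bag_of_adj _ _ _ := ⟨(), by simp⟩
  connected v := by
    have : Nonempty {x : Unit | v ∈ (Finset.univ : Finset V)} := ⟨⟨(), by simp⟩⟩
    exact ⟨.of_subsingleton⟩

end TreeDecomposition

/-- The treewidth of a finite graph: the minimum width of a tree-decomposition. -/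
noncomputable def treewidth {V : Type u} [Finite V] (G : SimpleGraph V) : ℤ :=
  sInf {w : ℤ | ∃ D : TreeDecomposition G, D.width = w}

/-- The simple treewidth of a finite graph: the minimum `k` such that there is a `k`-simple
tree-decomposition. -/
noncomputable def simpleTreewidth {V : Type u} [Finite V] (G : SimpleGraph V) : ℕ :=
  sInf {k : ℕ | ∃ D : TreeDecomposition G, D.IsSimple k}

/-- The minimum in the definition of the treewidth is attained, and it is a minimum. -/
theorem treewidth_isLeast {V : Type u} [Finite V] (G : SimpleGraph V) :
    IsLeast {w : ℤ | ∃ D : TreeDecomposition G, D.width = w} G.treewidth := by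
  have := Fintype.ofFinite V
  have hne : {w : ℤ | ∃ D : TreeDecomposition G, D.width = w}.Nonempty :=
    ⟨_, TreeDecomposition.trivial G, rfl⟩
  have hbd : BddBelow {w : ℤ | ∃ D : TreeDecomposition G, D.width = w} := by
    refine ⟨-1, ?_⟩
    rintro w ⟨D, rfl⟩
    exact D.neg_one_le_width
  exact ⟨Int.csInf_mem hne hbd, fun w hw => csInf_le hbd hw⟩

/-- The minimum in the definition of the simple treewidth is attained, and it is a minimum. -/
theorem simpleTreewidth_isLeast {V : Type u} [Finite V] (G : SimpleGraph V) :
    IsLeast {k : ℕ | ∃ D : TreeDecomposition G, D.IsSimple k} G.simpleTreewidth := by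
  have := Fintype.ofFinite V
  have hne : {k : ℕ | ∃ D : TreeDecomposition G, D.IsSimple k}.Nonempty := by
    refine ⟨Fintype.card V, TreeDecomposition.trivial G, ?_, ?_⟩
    · rw [TreeDecomposition.width_le_iff]
      intro x
      have : ((TreeDecomposition.trivial G).bag x).card ≤ Fintype.card V := Finset.card_le_univ _
      omega
    · intro S _
      have h : {x : Unit | S ⊆ (TreeDecomposition.trivial G).bag x}.ncard ≤ Nat.card Unit :=
        Set.ncard_le_card _
      simp only [Nat.card_unique] at h
      exact h.trans (by norm_num)
  exact ⟨Nat.sInf_mem hne, fun k hk => Nat.sInf_le hk⟩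

end SimpleGraph

namespace Digraph

/-- A digraph is oriented if it never has arcs in both directions between two vertices (in
particular it has no loops). -/
def IsOriented {V : Type u} (H : Digraph V) : Prop :=
  ∀ x y : V, H.Adj x y → ¬ H.Adj y x

/-- The indegree of a vertex of a finite digraph. -/
noncomputable def indegree {V : Type u} [Finite V] (H : Digraph V) (v : V) : ℕ :=
  {x : V | H.Adj x v}.ncard

/-- The maximum indegree of a finite digraph. -/
noncomputable def maxIndegree {V : Type u} [Finite V] (H : Digraph V) : ℕ :=
  ⨆ v : V, H.indegree v

/-- The directed product of two digraphs. -/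
def directedProduct {V₁ V₂ : Type u} (H₁ : Digraph V₁) (H₂ : Digraph V₂) : Digraph (V₁ × V₂) where
  Adj p q :=
    (p.1 = q.1 ∧ H₂.Adj p.2 q.2) ∨ (p.2 = q.2 ∧ H₁.Adj p.1 q.1) ∨
      (H₁.Adj p.1 q.1 ∧ H₂.Adj p.2 q.2)

end Digraph

/-! Order the vertices so that, in a chordal supergraph, the smaller neighbours `P v` of each `v`
form a clique of at most `k` vertices, and give every vertex two coordinates. A value `b` receives
arcs in a coordinate only if the vertex `b` has itself as that coordinate, and then from the
coordinates of `P b`.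

If some coordinate takes fewer than `k` values on `P v`, then `v` becomes its own value there, at
the cost of at most `k - 1` arcs, and copies the largest other coordinate. Otherwise both
coordinates are injective on the `k`-set `P v`. Its largest element `l` then has a fresh coordinate
(`ChosenAt.fresh_of_injOn`), which `v` reuses together with the largest other coordinate of the
rest; no arc has to be added (`arcLE_or_arcLE`).

Cliques project to cliques, so the same order eliminates both digraphs and treewidth is bounded by
indegree (`isElimination_inArcs`). Simplicity serves only for injectivity: two vertices in the same
position would give, with `l`, three cliques of size `k + 1` sharing `k` vertices
(`injective_of_chosenAt`). -/

/-- Recursive choice: a property of functions that depends only on initial segments, and that can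
always be extended by one more value, holds everywhere for some function. -/
theorem exists_forall_of_extend {α β : Type*} [LinearOrder α] [WellFoundedLT α] [Nonempty β]
    (C : (α → β) → α → Prop)
    (hcongr : ∀ f g v, (∀ u ≤ v, f u = g u) → C f v → C g v)
    (hext : ∀ f v, (∀ u < v, C f u) → ∃ x, C (Function.update f v x) v) :
    ∃ f, ∀ v, C f v := by
  classical
  -- The values from `v` upwards are junk: the one at `v` gets overwritten, and `hcongr` makes the
  -- later ones irrelevant.
  let ext (v : α) (h : ∀ u, u < v → β) : α → β :=
    fun u => if hu : u < v then h u hu else Classical.arbitrary β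
  let F : ∀ v, (∀ u, u < v → β) → β := fun v h =>
    Classical.epsilon fun x => C (Function.update (ext v h) v x) v
  let f : α → β := wellFounded_lt.fix F
  have hf (v : α) : f v = F v fun u _ => f u := wellFounded_lt.fix_eq F v
  refine ⟨f, fun v => ?_⟩
  refine wellFounded_lt.induction (C := fun v => C f v) v fun v ih => ?_
  have hlt : ∀ u < v, ext v (fun u _ => f u) u = f u := fun u hu => by simp [ext, hu]
  have h1 := hext (ext v fun u _ => f u) v fun u hu =>
    hcongr f _ u (fun w hw => (hlt w (hw.trans_lt hu)).symm) (ih u hu)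
  have h2 := Classical.epsilon_spec h1
  refine hcongr _ f v (fun u hu => ?_) h2
  rcases hu.eq_or_lt with rfl | hu
  · rw [Function.update_self, hf]
  · rw [Function.update_of_ne hu.ne, hlt u hu]

/-- A family of neighbourhoods of smaller elements, each of which is a clique: `P v` is the set of
smaller neighbours of `v` in a chordal graph with a perfect elimination ordering. -/
structure IsElimination {α : Type*} [LinearOrder α] (P : α → Finset α) : Prop where
  lt : ∀ {u v}, u ∈ P v → u < v
  clique : ∀ {u w v}, u ∈ P v → w ∈ P v → u < w → u ∈ P w

/-! ### Choice of the two coordinates -/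

section Coordinates

variable {α : Type*} [LinearOrder α]

/-- The coordinate `i` of `v` is new, and the other one is the largest one that occurs
in `P v`. -/
structure FreshAt (k : ℕ) (P : α → Finset α) (f : α → Bool → α) (v : α) (i : Bool) : Prop where
  eq_self : f v i = v
  card_lt : ((P v).image (f · i)).card < k
  other : P v = ∅ ∧ f v (!i) = v ∨
    ∃ w ∈ P v, f v (!i) = f w (!i) ∧ ∀ u ∈ P v, f u (!i) ≤ f w (!i)

/-- The vertex `v` completes a square whose diagonal is in `P v`: it has the coordinate `i` of the
largest element `l` of `P v` and the largest other coordinate of the elements of `P v \ {l}`. -/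
structure FillAt (k : ℕ) (P : α → Finset α) (f : α → Bool → α) (v : α) (i : Bool) (l : α) :
    Prop where
  card_eq : (P v).card = k
  injOn : ∀ j, Set.InjOn (f · j) (P v : Set α)
  mem : l ∈ P v
  le : ∀ u ∈ P v, u ≤ l
  fresh : FreshAt k P f l i
  eq_left : f v i = l
  other : ∃ w ∈ P v, w ≠ l ∧ f v (!i) = f w (!i) ∧ ∀ u ∈ P v, u ≠ l → f u (!i) ≤ f w (!i)

/-- The rule by which the coordinates of `v` are chosen. -/
def ChosenAt (k : ℕ) (P : α → Finset α) (f : α → Bool → α) (v : α) : Prop :=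
  ∃ i, FreshAt k P f v i ∨ ∃ l, FillAt k P f v i l

variable {k : ℕ} {P : α → Finset α} {f g : α → Bool → α}

theorem FreshAt.congr (hP : IsElimination P) {v : α} {i : Bool} (h : FreshAt k P f v i)
    (hfg : ∀ u ≤ v, f u = g u) : FreshAt k P g v i := by
  have hlt : ∀ u ∈ P v, f u = g u := fun u hu => hfg u (hP.lt hu).le
  refine ⟨hfg v le_rfl ▸ h.eq_self, ?_, ?_⟩
  · rw [← Finset.image_congr (f := (f · i))]
    · exact h.card_lt
    · intro u hu
      simp only [hlt u hu]
  · rcases h.other with ⟨h1, h2⟩ | ⟨w, hw, h1, h2⟩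
    · exact .inl ⟨h1, hfg v le_rfl ▸ h2⟩
    · refine .inr ⟨w, hw, ?_, fun u hu => ?_⟩
      · rw [← hfg v le_rfl, ← hlt w hw, h1]
      · rw [← hlt u hu, ← hlt w hw]
        exact h2 u hu

theorem ChosenAt.congr (hP : IsElimination P) {v : α} (h : ChosenAt k P f v)
    (hfg : ∀ u ≤ v, f u = g u) : ChosenAt k P g v := by
  have hlt : ∀ u ∈ P v, f u = g u := fun u hu => hfg u (hP.lt hu).le
  obtain ⟨i, h | ⟨l, h⟩⟩ := h
  · exact ⟨i, .inl (h.congr hP hfg)⟩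
  refine ⟨i, .inr ⟨l, h.card_eq, fun j u hu w hw huw => ?_, h.mem, h.le, ?_, ?_, ?_⟩⟩
  · simp only [← hlt u hu, ← hlt w hw] at huw
    exact h.injOn j hu hw huw
  · exact h.fresh.congr hP fun u hu => hfg u (hu.trans (hP.lt h.mem).le)
  · rw [← hfg v le_rfl, h.eq_left]
  · obtain ⟨w, hw, hne, h1, h2⟩ := h.other
    refine ⟨w, hw, hne, ?_, fun u hu hul => ?_⟩
    · rw [← hfg v le_rfl, ← hlt w hw, h1]
    · rw [← hlt u hu, ← hlt w hw]
      exact h2 u hu hul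

/-- Both coordinates are inherited from elements of `P v`. A filling vertex thus never introduces a
value, and so never creates arcs. -/
theorem FillAt.lt (hP : IsElimination P) {v l : α} {i : Bool} (h : FillAt k P f v i l)
    (hle : ∀ u < v, ∀ j, f u j ≤ u) (j : Bool) : f v j < v := by
  obtain ⟨w, hw, -, hfw, -⟩ := h.other
  rcases Bool.eq_or_eq_not j i with rfl | rfl
  · exact h.eq_left ▸ hP.lt h.mem
  · exact hfw ▸ (hle w (hP.lt hw) _).trans_lt (hP.lt hw)

theorem ChosenAt.le [WellFoundedLT α] (hP : IsElimination P) (v : α)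
    (h : ∀ u ≤ v, ChosenAt k P f u) (j : Bool) : f v j ≤ v := by
  revert j h
  refine wellFounded_lt.induction
    (C := fun v => (∀ u ≤ v, ChosenAt k P f u) → ∀ j, f v j ≤ v) v fun v ih h j => ?_
  have hle : ∀ u < v, ∀ j, f u j ≤ u := fun u hu => ih u hu fun w hw => h w (hw.trans hu.le)
  obtain ⟨i, hi | ⟨l, hl⟩⟩ := h v le_rfl
  · rcases Bool.eq_or_eq_not j i with rfl | rfl
    · exact hi.eq_self.le
    · rcases hi.other with h1 | ⟨w, hw, h1, -⟩
      · exact h1.2.le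
      · exact h1 ▸ (hle w (hP.lt hw) _).trans (hP.lt hw).le
  · exact (hl.lt hP hle j).le

/-- If both coordinates are injective on `P v` and `P v` has `k` elements, then the largest element
of `P v` has a new coordinate. -/
theorem ChosenAt.fresh_of_injOn (hk : 2 ≤ k) (hP : IsElimination P) {v l : α}
    (hcard : (P v).card = k) (hinj : ∀ j, Set.InjOn (f · j) (P v : Set α)) (hl : l ∈ P v)
    (hmax : ∀ u ∈ P v, u ≤ l) (h : ChosenAt k P f l) : ∃ i, FreshAt k P f l i := by
  obtain ⟨i, h | ⟨m, h⟩⟩ := h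
  · exact ⟨i, h⟩
  -- Otherwise `l` copies one coordinate from `m` and the other from `w`, both in `P l`. Injectivity
  -- keeps both out of `P v`, whose elements below `l` lie in `P l`; this leaves at most `1 + (k -
  -- 2)` elements.
  exfalso
  obtain ⟨w, hw, hwm, hfw, -⟩ := h.other
  have hm : m ∉ P v := fun hm =>
    (hP.lt h.mem).ne (hinj i hm hl (h.fresh.eq_self.trans h.eq_left.symm))
  have hw' : w ∉ P v := fun hw' => (hP.lt hw).ne (hinj (!i) hw' hl hfw.symm)
  have hsub : P v ⊆ insert l (((P l).erase m).erase w) := by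
    intro u hu
    rcases (hmax u hu).eq_or_lt with rfl | hlt
    · exact Finset.mem_insert_self _ _
    · refine Finset.mem_insert_of_mem (Finset.mem_erase.2 ⟨?_, Finset.mem_erase.2 ⟨?_, ?_⟩⟩)
      · exact ne_of_mem_of_not_mem hu hw'
      · exact ne_of_mem_of_not_mem hu hm
      · exact hP.clique hu hl hlt
  have h1 := (Finset.card_le_card hsub).trans (Finset.card_insert_le _ _)
  rw [Finset.card_erase_of_mem (Finset.mem_erase.2 ⟨hwm, hw⟩), Finset.card_erase_of_mem h.mem,
    h.card_eq, hcard] at h1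
  omega

theorem ChosenAt.exists_update (hk : 2 ≤ k) (hP : IsElimination P) (v : α)
    (hcard : (P v).card ≤ k) (h : ∀ u < v, ChosenAt k P f u) :
    ∃ x, ChosenAt k P (Function.update f v x) v := by
  have hlt (x : Bool → α) : ∀ u < v, Function.update f v x u = f u := fun u hu =>
    Function.update_of_ne hu.ne _ _
  have hmem (x : Bool → α) : ∀ u ∈ P v, Function.update f v x u = f u := fun u hu =>
    hlt x u (hP.lt hu)
  by_cases hex : ∃ i, ((P v).image (f · i)).card < k
  · obtain ⟨i, hi⟩ := hex
    obtain ⟨m, hm⟩ : ∃ m, P v = ∅ ∧ m = v ∨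
        ∃ w ∈ P v, m = f w (!i) ∧ ∀ u ∈ P v, f u (!i) ≤ f w (!i) := by
      rcases (P v).eq_empty_or_nonempty with h0 | h0
      · exact ⟨v, .inl ⟨h0, rfl⟩⟩
      · obtain ⟨w, hw, hmax⟩ := (P v).exists_max_image (f · (!i)) h0
        exact ⟨f w (!i), .inr ⟨w, hw, rfl, hmax⟩⟩
    refine ⟨Function.update (fun _ => m) i v, i, .inl ⟨by simp, ?_, ?_⟩⟩
    · rwa [Finset.image_congr (g := (f · i))]
      intro u hu
      simp only [hmem _ u hu]
    · refine hm.imp (fun h => ⟨h.1, by simp [h.2]⟩) ?_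
      rintro ⟨w, hw, rfl, h2⟩
      refine ⟨w, hw, by simp [hmem _ w hw], fun u hu => ?_⟩
      rw [hmem _ u hu, hmem _ w hw]
      exact h2 u hu
  · push Not at hex
    have hcard' : (P v).card = k :=
      le_antisymm hcard ((hex true).trans Finset.card_image_le)
    have hinj (j) : Set.InjOn (f · j) (P v : Set α) :=
      Finset.card_image_iff.1 (le_antisymm Finset.card_image_le (hcard'.trans_le (hex j)))
    have h0 : (P v).Nonempty := Finset.card_pos.1 (by omega)
    obtain ⟨l, hl, hmax⟩ := (P v).exists_max_image id h0
    obtain ⟨i, hi⟩ := ChosenAt.fresh_of_injOn hk hP hcard' hinj hl hmax (h l (hP.lt hl))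
    have h1 : ((P v).erase l).Nonempty :=
      Finset.card_pos.1 (by rw [Finset.card_erase_of_mem hl]; omega)
    obtain ⟨w, hw, hwmax⟩ := ((P v).erase l).exists_max_image (f · (!i)) h1
    rw [Finset.mem_erase] at hw
    refine ⟨Function.update (fun _ => f w (!i)) i l, i, .inr ⟨l, hcard', ?_, hl, hmax, ?_, ?_, ?_⟩⟩
    · intro j u hu u' hu' huu
      simp only [hmem _ u hu, hmem _ u' hu'] at huu
      exact hinj j hu hu' huu
    · exact hi.congr hP fun u hu => (hlt _ u (hu.trans_lt (hP.lt hl))).symm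
    · simp
    · refine ⟨w, hw.2, hw.1, by simp [hmem _ w hw.2], fun u hu hul => ?_⟩
      rw [hmem _ u hu, hmem _ w hw.2]
      exact hwmax u (Finset.mem_erase.2 ⟨hul, hu⟩)

theorem exists_forall_chosenAt [WellFoundedLT α] [Nonempty α] (hk : 2 ≤ k) (hP : IsElimination P)
    (hcard : ∀ v, (P v).card ≤ k) : ∃ f, ∀ v, ChosenAt k P f v :=
  exists_forall_of_extend _ (fun _ _ _ hfg h => h.congr hP hfg)
    fun _ v h => ChosenAt.exists_update hk hP v (hcard v) h

end Coordinates

/-! ### The coordinate digraphs -/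

section Arcs

variable {α : Type*} [LinearOrder α] {k : ℕ} {P : α → Finset α} {f : α → Bool → α}

/-- The in-neighbours of `b` in the digraph of the coordinate `i`. -/
def inArcs (P : α → Finset α) (f : α → Bool → α) (i : Bool) (b : α) : Finset α :=
  if f b i = b then (P b).image (f · i) else ∅

/-- In every coordinate, there is an arc from `u` to `v` or equality. -/
def ArcLE (P : α → Finset α) (f : α → Bool → α) (u v : α) : Prop :=
  ∀ i, f u i = f v i ∨ f u i ∈ inArcs P f i (f v i)

theorem mem_inArcs {i : Bool} {a b : α} :
    a ∈ inArcs P f i b ↔ f b i = b ∧ ∃ u ∈ P b, f u i = a := by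
  unfold inArcs
  split_ifs with h <;> simp [h]

/-- A value has in-neighbours only if its own vertex introduced it. A filling vertex introduces
none, and a fresh one can equal its copied coordinate only when `P b` is empty. -/
theorem card_inArcs_lt [WellFoundedLT α] (hk : 0 < k) (hP : IsElimination P)
    (h : ∀ v, ChosenAt k P f v) (i : Bool) (b : α) : (inArcs P f i b).card < k := by
  have hle v j := ChosenAt.le hP v (fun u _ => h u) j
  unfold inArcs
  split_ifs with hb
  · obtain ⟨j, hj | ⟨l, hl⟩⟩ := h b
    · rcases Bool.eq_or_eq_not i j with rfl | rfl
      · exact hj.card_lt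
      · rcases hj.other with h1 | ⟨w, hw, h1, -⟩
        · simpa [h1.1] using hk
        · exact absurd (hb ▸ h1 ▸ hle w _) (hP.lt hw).not_ge
    · exact absurd hb (hl.lt hP (fun u _ => hle u) i).ne
  · simpa using hk

theorem lt_of_mem_inArcs (hP : IsElimination P) (hle : ∀ v i, f v i ≤ v) {i : Bool} {a b : α}
    (h : a ∈ inArcs P f i b) : a < b := by
  obtain ⟨-, u, hu, rfl⟩ := mem_inArcs.1 h
  exact (hle u i).trans_lt (hP.lt hu)

theorem ArcLE.le (hP : IsElimination P) (hle : ∀ v i, f v i ≤ v) {u v : α} (h : ArcLE P f u v)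
    (i : Bool) : f u i ≤ f v i :=
  (h i).elim (·.le) fun h => (lt_of_mem_inArcs hP hle h).le

/-- Arcs increase both coordinates weakly. If the arc of the pair runs against the comparison in one
coordinate, equality is forced there. This is why a largest coordinate is copied: all others then
compare with it correctly. -/
theorem arc_of_le (hP : IsElimination P) (hle : ∀ v i, f v i ≤ v) {u v : α}
    (h : u = v ∨ ArcLE P f u v ∨ ArcLE P f v u) {i : Bool} (huv : f u i ≤ f v i) :
    f u i = f v i ∨ f u i ∈ inArcs P f i (f v i) := by
  rcases h with rfl | h | h
  · exact .inl rfl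
  · exact h i
  · exact .inl (huv.antisymm (h.le hP hle i))

theorem FreshAt.arcLE (hP : IsElimination P) (hle : ∀ v i, f v i ≤ v) {v : α} {i : Bool}
    (h : FreshAt k P f v i)
    (hpair : ∀ u ∈ P v, ∀ w ∈ P v, u = w ∨ ArcLE P f u w ∨ ArcLE P f w u) :
    ∀ u ∈ P v, ArcLE P f u v := by
  intro u hu j
  rcases Bool.eq_or_eq_not j i with rfl | rfl
  · rw [h.eq_self]
    exact .inr (mem_inArcs.2 ⟨h.eq_self, u, hu, rfl⟩)
  · rcases h.other with ⟨h1, -⟩ | ⟨w, hw, h1, h2⟩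
    · simp [h1] at hu
    · rw [h1]
      exact arc_of_le hP hle (hpair u hu w hw) (h2 u hu)

/-- For fresh `v` all arcs enter `v`. For filling `v` the arc to `l` is reversed: they agree in the
fresh coordinate of `l`, and the other coordinate of `v` comes from some `w ∈ P l`. The rest of `P
v` lies in `P l`, so its arcs into the fresh coordinate of `l` already exist. -/
theorem arcLE_or_arcLE [WellFoundedLT α] (hP : IsElimination P) (h : ∀ v, ChosenAt k P f v)
    (v : α) : ∀ u ∈ P v, ArcLE P f u v ∨ ArcLE P f v u := by
  have hle v j := ChosenAt.le hP v (fun u _ => h u) j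
  refine wellFounded_lt.induction
    (C := fun v => ∀ u ∈ P v, ArcLE P f u v ∨ ArcLE P f v u) v fun v ih => ?_
  have hpair : ∀ x ≤ v, ∀ u ∈ P x, ∀ w ∈ P x, u = w ∨ ArcLE P f u w ∨ ArcLE P f w u := by
    intro x hx u hu w hw
    rcases lt_trichotomy u w with huw | huw | huw
    · exact .inr (ih w ((hP.lt hw).trans_le hx) u (hP.clique hu hw huw))
    · exact .inl huw
    · exact .inr (ih u ((hP.lt hu).trans_le hx) w (hP.clique hw hu huw)).symm
  obtain ⟨i, hi | ⟨l, hl⟩⟩ := h v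
  · exact fun u hu => .inl (hi.arcLE hP hle (hpair v le_rfl) u hu)
  have hlv := hP.lt hl.mem
  obtain ⟨w, hw, hwl, hfw, hmax⟩ := hl.other
  have hfresh := hl.fresh.arcLE hP hle (hpair l hlv.le)
  intro u hu
  rcases (hl.le u hu).eq_or_lt with rfl | hul
  · refine .inr fun j => ?_
    rcases Bool.eq_or_eq_not j i with rfl | rfl
    · exact .inl (hl.eq_left.trans hl.fresh.eq_self.symm)
    · rw [hfw]
      exact hfresh w (hP.clique hw hl.mem ((hl.le w hw).lt_of_ne hwl)) _
  · refine .inl fun j => ?_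
    rcases Bool.eq_or_eq_not j i with rfl | rfl
    · rw [hl.eq_left, ← hl.fresh.eq_self]
      exact hfresh u (hP.clique hu hl.mem hul) j
    · rw [hfw]
      exact arc_of_le hP hle (hpair v le_rfl u hu w hw) (hmax u hu hul.ne)

/-- Two in-neighbours of a value are coordinates of two members of one clique `P b`, hence equal or
joined by an arc, which points upwards. -/
theorem isElimination_inArcs [WellFoundedLT α] (hP : IsElimination P)
    (h : ∀ v, ChosenAt k P f v) (i : Bool) : IsElimination (inArcs P f i) where
  lt := lt_of_mem_inArcs hP fun v j => ChosenAt.le hP v (fun u _ => h u) j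
  clique {a a' b} ha ha' haa := by
    have hle v j := ChosenAt.le hP v (fun u _ => h u) j
    obtain ⟨-, u, hu, rfl⟩ := mem_inArcs.1 ha
    obtain ⟨-, w, hw, rfl⟩ := mem_inArcs.1 ha'
    refine (arc_of_le hP hle ?_ haa.le).resolve_left haa.ne
    rcases lt_trichotomy u w with huw | huw | huw
    · exact .inr (arcLE_or_arcLE hP h w u (hP.clique hu hw huw))
    · exact .inl huw
    · exact .inr (arcLE_or_arcLE hP h u w (hP.clique hw hu huw)).symm

/-- The clique below a vertex that completes a square is determined by its largest element. -/
theorem FillAt.eq_erase (hP : IsElimination P) (hcard : ∀ v, (P v).card ≤ k)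
    {v l c : α} {i : Bool} (h : FillAt k P f v i l) (hc : c ∈ P l) (hfc : f l (!i) = f c (!i)) :
    P v = (insert l (P l)).erase c ∧ (P l).card = k := by
  have hcl := hP.lt hc
  have hsub : P v ⊆ (insert l (P l)).erase c := by
    intro u hu
    refine Finset.mem_erase.2 ⟨?_, ?_⟩
    · rintro rfl
      exact hcl.ne (h.injOn (!i) hu h.mem hfc.symm)
    · rcases (h.le u hu).eq_or_lt with rfl | hul
      · exact Finset.mem_insert_self _ _
      · exact Finset.mem_insert_of_mem (hP.clique hu h.mem hul)
  have h1 : ((insert l (P l)).erase c).card = (P l).card := by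
    rw [Finset.card_erase_of_mem (Finset.mem_insert_of_mem hc),
      Finset.card_insert_of_notMem fun hl => (hP.lt hl).false, Nat.add_sub_cancel]
  have h2 := Finset.card_le_card hsub
  have h3 := hcard l
  rw [h1, h.card_eq] at h2
  exact ⟨Finset.eq_of_subset_of_card_le hsub (by rw [h1, h.card_eq]; exact h3), by omega⟩

/-- If `u < v` coincide, both fill a square over the same `l`, and `P u = P v` is `P l` with `l`
added and one vertex `c` removed. Then `l`, `u` and `v` each complete a clique of size `k + 1`
containing the `k`-set `P v`, one too many. -/
theorem injective_of_chosenAt [Finite α] (hP : IsElimination P)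
    (hcard : ∀ v, (P v).card ≤ k)
    (hsimple : ∀ D : Finset α, D.card = k →
      {v | (P v).card = k ∧ D ⊆ insert v (P v)}.ncard ≤ 2)
    (h : ∀ v, ChosenAt k P f v) : Function.Injective f := by
  have hle v j := ChosenAt.le hP v (fun u _ => h u) j
  have main : ∀ u v, u < v → f u ≠ f v := by
    intro u v huv hfuv
    obtain ⟨i, hi | ⟨l, hl⟩⟩ := h v
    · exact (hle u i).not_gt (by rw [hfuv, hi.eq_self]; exact huv)
    obtain ⟨w, hw, hwl, hfw, -⟩ := hl.other
    have hwl' : w < l := (hl.le w hw).lt_of_ne hwl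
    have hui : f u i = l := by rw [hfuv, hl.eq_left]
    have hui' : f u (!i) = f w (!i) := by rw [hfuv, hfw]
    have hlu : l < u := by
      refine (hui ▸ hle u i : l ≤ u).lt_of_ne ?_
      rintro rfl
      exact hwl (hl.injOn (!i) hw hl.mem hui'.symm)
    have hwle : f u (!i) < l := hui' ▸ (hle w _).trans_lt hwl'
    -- Both coordinates of `u` are below `u`, so `u` is not fresh. If it reused its coordinate `!i`
    -- from `m`, then `m < l`, yet its coordinate `l` would come from some `x ≤ m`.
    have hfill : FillAt k P f u i l := by
      obtain ⟨j, hj | ⟨m, hm⟩⟩ := h u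
      · rcases Bool.eq_or_eq_not j i with rfl | rfl
        · exact absurd (hui.symm.trans hj.eq_self) hlu.ne
        · exact absurd hj.eq_self (hwle.trans hlu).ne
      · rcases Bool.eq_or_eq_not j i with rfl | rfl
        · rwa [← hm.eq_left.symm.trans hui]
        · obtain ⟨x, hx, hxm, hfx, -⟩ := hm.other
          rw [Bool.not_not, hui] at hfx
          rw [hm.eq_left] at hwle
          exact absurd (hfx ▸ hle x i : l ≤ x) ((hm.le x hx).trans_lt hwle).not_ge
    obtain ⟨c, hc, hfc⟩ : ∃ c ∈ P l, f l (!i) = f c (!i) := by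
      rcases hl.fresh.other with ⟨h0, -⟩ | ⟨c, hc, hfc, -⟩
      · have := hP.clique hw hl.mem hwl'
        simp [h0] at this
      · exact ⟨c, hc, hfc⟩
    obtain ⟨hv, hlk⟩ := hl.eq_erase hP hcard hc hfc
    obtain ⟨hu, -⟩ := hfill.eq_erase hP hcard hc hfc
    have hsub : (({l, u, v} : Finset α) : Set α) ⊆
        {x | (P x).card = k ∧ P v ⊆ insert x (P x)} := by
      intro x hx
      simp only [Finset.coe_insert, Finset.coe_singleton, Set.mem_insert_iff,
        Set.mem_singleton_iff] at hx
      rcases hx with rfl | rfl | rfl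
      · exact ⟨hlk, hv ▸ Finset.erase_subset _ _⟩
      · exact ⟨hfill.card_eq, by rw [hv, ← hu]; exact Finset.subset_insert _ _⟩
      · exact ⟨hl.card_eq, Finset.subset_insert _ _⟩
    have h3 := (Set.ncard_le_ncard hsub (Set.toFinite _)).trans (hsimple _ hl.card_eq)
    rw [Set.ncard_coe_finset, Finset.card_eq_three.2
      ⟨l, u, v, hlu.ne, (hlu.trans huv).ne, huv.ne, rfl⟩] at h3
    omega
  intro u v huv
  rcases lt_trichotomy u v with hlt | heq | hlt
  · exact absurd huv (main u v hlt)
  · exact heq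
  · exact absurd huv.symm (main v u hlt)

end Arcs

/-! ### Elimination orderings and tree-decompositions -/

namespace SimpleGraph

/-- The tree on `α` with an additional root, in which the parent of `b` is the largest element of
`Q b`, or the root if `Q b` is empty. -/
def maxTree {α : Type*} [LinearOrder α] (Q : α → Finset α) : SimpleGraph (WithBot α) :=
  SimpleGraph.fromRel fun x y => ∃ b : α, y = b ∧ x = (Q b).max

theorem maxTree_adj {α : Type*} [LinearOrder α] {Q : α → Finset α} (hQ : IsElimination Q) (b : α) :
    (maxTree Q).Adj (Q b).max b := by
  refine ⟨fun h => ?_, .inl ⟨b, rfl, rfl⟩⟩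
  exact (hQ.lt (Finset.mem_of_max h)).false

/-- Passing to parents decreases, so the root is reached and the graph is connected. Each non-root
node contributes at most one edge, so the edge count forces a tree. -/
theorem maxTree_isTree {α : Type*} [LinearOrder α] [Finite α] {Q : α → Finset α}
    (hQ : IsElimination Q) : (maxTree Q).IsTree := by
  have := Fintype.ofFinite α
  have hconn : (maxTree Q).Connected := by
    rw [connected_iff_exists_forall_reachable]
    refine ⟨⊥, fun x => ?_⟩
    induction x with
    | bot => exact .refl _
    | coe b =>
      refine wellFounded_lt.induction (C := fun b : α => (maxTree Q).Reachable ⊥ b) b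
        fun b ih => ?_
      refine Reachable.trans ?_ (maxTree_adj hQ b).reachable
      rcases (Q b).eq_empty_or_nonempty with h0 | h0
      · rw [h0, Finset.max_empty]
      · rw [← Finset.coe_max' h0]
        exact ih _ (hQ.lt (Finset.max'_mem _ h0))
  have : Finite (WithBot α) := inferInstanceAs (Finite (Option α))
  refine isTree_iff_connected_and_card.2 ⟨hconn, ?_⟩
  refine le_antisymm ?_ hconn.card_vert_le_card_edgeSet_add_one
  have hsub : (maxTree Q).edgeSet ⊆ Set.range fun b : α => s((Q b).max, (b : WithBot α)) := by
    intro e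
    induction e with
    | _ x y =>
      rintro ⟨-, ⟨b, rfl, rfl⟩ | ⟨b, rfl, rfl⟩⟩
      · exact ⟨b, rfl⟩
      · exact ⟨b, Sym2.eq_swap⟩
  have h1 : Nat.card (maxTree Q).edgeSet ≤ Nat.card α :=
    (Nat.card_mono (Set.finite_range _) hsub).trans (Finite.card_range_le _)
  have h2 : Nat.card (WithBot α) = Nat.card α + 1 := Finite.card_option
  omega

/-- The tree-decomposition given by a perfect elimination ordering of a chordal supergraph. -/
noncomputable def TreeDecomposition.ofElimination {α : Type} [LinearOrder α] [Finite α]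
    (G : SimpleGraph α) {Q : α → Finset α} (hQ : IsElimination Q)
    (hadj : ∀ a b, a < b → G.Adj a b → a ∈ Q b) : TreeDecomposition G where
  Node := WithBot α
  finite_node := inferInstanceAs (Finite (Option α))
  tree := maxTree Q
  isTree := maxTree_isTree hQ
  -- The root has an empty bag; it keeps the tree non-null even when `α` is empty.
  bag x := x.recBotCoe ∅ fun b => insert b (Q b)
  exists_bag_of_adj v w h := by
    rcases lt_trichotomy v w with hlt | rfl | hlt
    · exact ⟨w, Finset.mem_insert_of_mem (hadj v w hlt h), Finset.mem_insert_self _ _⟩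
    · exact (G.loopless.irrefl _ h).elim
    · exact ⟨v, Finset.mem_insert_self _ _, Finset.mem_insert_of_mem (hadj w v hlt h.symm)⟩
  connected a := by
    rw [connected_iff_exists_forall_reachable]
    refine ⟨⟨(a : WithBot α), Finset.mem_insert_self _ _⟩, ?_⟩
    rintro ⟨x, hx⟩
    induction x with
    | bot => exact absurd hx (Finset.notMem_empty a)
    | coe b =>
      induction b using WellFoundedLT.induction with | _ b ih
      rcases Finset.mem_insert.1 hx with rfl | hab
      · exact .refl _
      have h0 : (Q b).Nonempty := ⟨a, hab⟩
      have hm := Finset.max'_mem _ h0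
      -- The clique property puts `a` into the bag of the parent of `b`, so the walk towards node
      -- `a` stays inside the subtree of `a`.
      have ham : a ∈ insert ((Q b).max' h0) (Q ((Q b).max' h0)) := by
        rcases (Finset.le_max' _ _ hab).eq_or_lt with h | h
        · exact h ▸ Finset.mem_insert_self _ _
        · exact Finset.mem_insert_of_mem (hQ.clique hab hm h)
      refine (ih _ (hQ.lt hm) ham).trans (Adj.reachable ?_)
      have := maxTree_adj hQ b
      rwa [← Finset.coe_max' h0] at this

theorem treewidth_le_of_isElimination {α : Type} [LinearOrder α] [Finite α]
    (G : SimpleGraph α) {Q : α → Finset α} (hQ : IsElimination Q)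
    (hadj : ∀ a b, a < b → G.Adj a b → a ∈ Q b) {w : ℕ} (hw : ∀ b, (Q b).card ≤ w) :
    G.treewidth ≤ w := by
  refine (G.treewidth_isLeast.2 ⟨TreeDecomposition.ofElimination G hQ hadj, rfl⟩).trans ?_
  rw [TreeDecomposition.width_le_iff]
  intro x
  induction x using WithBot.recBotCoe with
  | bot =>
    change ((∅ : Finset α).card : ℤ) - 1 ≤ w
    simp
  | coe b =>
    change ((insert b (Q b)).card : ℤ) - 1 ≤ w
    have h1 := Finset.card_insert_le b (Q b)
    have h2 := hw b
    omega

/-- In a tree, every path from a vertex of a subtree to a root `r` passes through the vertex of the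
subtree that is closest to `r`, and leaves the subtree there. -/
theorem IsTree.mem_of_mem_of_dist_le {N : Type*} {T : SimpleGraph N} (hT : T.IsTree) (r : N)
    {A B : Set N} (hA : (T.induce A).Connected) (hB : (T.induce B).Connected) {z a b : N}
    (hzA : z ∈ A) (hzB : z ∈ B) (ha : a ∈ A) (hb : b ∈ B)
    (hamin : ∀ x ∈ A, T.dist a r ≤ T.dist x r) (hbmin : ∀ x ∈ B, T.dist b r ≤ T.dist x r)
    (hab : T.dist a r ≤ T.dist b r) : b ∈ A := by
  classical
  -- A path inside `A` to its closest vertex `a`, followed by a geodesic to `r`, is a path, since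
  -- the geodesic meets `A` only in `a`. The path from `z` to `r` is unique in a tree, so it
  -- contains both `a` and `b`.
  have key : ∀ (A : Set N) (a : N), (T.induce A).Connected → z ∈ A → a ∈ A →
      (∀ x ∈ A, T.dist a r ≤ T.dist x r) →
      ∃ (p : T.Walk z a) (q : T.Walk a r), (∀ x ∈ p.support, x ∈ A) ∧
        (∀ x ∈ q.support, x = a ∨ T.dist x r < T.dist a r) ∧ (p.append q).IsPath := by
    intro A a hA hz ha hmin
    obtain ⟨p, hp, hpA⟩ : ∃ p : T.Walk z a, p.IsPath ∧ ∀ x ∈ p.support, x ∈ A := by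
      obtain ⟨p, hp⟩ := (hA ⟨z, hz⟩ ⟨a, ha⟩).exists_isPath
      refine ⟨p.map (Embedding.induce A).toHom,
        hp.map (f := (Embedding.induce A).toHom) Subtype.val_injective, fun x hx => ?_⟩
      obtain ⟨y, -, rfl⟩ := List.mem_map.1 (Walk.support_map _ p ▸ hx)
      exact y.2
    obtain ⟨q, hq, hlen⟩ := hT.connected.exists_path_of_dist a r
    have hqlt : ∀ x ∈ q.support, x = a ∨ T.dist x r < T.dist a r := by
      intro x hx
      by_cases hxa : x = a
      · exact .inl hxa
      · right
        have h1 := congrArg Walk.length (q.take_spec hx)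
        rw [Walk.length_append] at h1
        have h2 : (q.takeUntil x hx).length ≠ 0 := fun h0 =>
          hxa (Walk.eq_of_length_eq_zero h0).symm
        have h3 := dist_le (q.dropUntil x hx)
        omega
    refine ⟨p, q, hpA, hqlt, ?_⟩
    rw [Walk.isPath_def] at hp hq ⊢
    rw [Walk.support_append, List.nodup_append']
    refine ⟨hp, hq.tail, fun x hx hx' => ?_⟩
    rcases hqlt x (List.mem_of_mem_tail hx') with rfl | hlt
    · rw [← Walk.cons_tail_support] at hq
      exact (List.nodup_cons.1 hq).1 hx'
    · exact (hmin x (hpA x hx)).not_gt hlt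
  obtain ⟨p, q, hp, hq, hpq⟩ := key A a hA hzA ha hamin
  obtain ⟨p', q', -, -, hpq'⟩ := key B b hB hzB hb hbmin
  have heq := congrArg Subtype.val
    ((hT.isAcyclic.subsingleton_path z r).elim ⟨_, hpq⟩ ⟨_, hpq'⟩)
  have hmem : b ∈ (p.append q).support := by
    change p.append q = p'.append q' at heq
    rw [heq, Walk.mem_support_append_iff]
    exact .inl p'.end_mem_support
  rcases (Walk.mem_support_append_iff _ _).1 hmem with h | h
  · exact hp b h
  · rcases hq b h with rfl | hlt
    · exact ha
    · exact absurd hab hlt.not_ge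

/-- A tree-decomposition of width at most `j` gives an elimination ordering with at most `j`
smaller neighbours. If it is `j`-simple, then every `j`-set is in at most two of
the largest cliques. -/
theorem TreeDecomposition.IsSimple.exists_isElimination {V : Type u} [Finite V]
    {G : SimpleGraph V} (D : TreeDecomposition G) {j : ℕ} (hD : D.IsSimple j) :
    ∃ (n : ℕ) (e : V ≃ Fin n) (P : Fin n → Finset (Fin n)), IsElimination P ∧
      (∀ v, (P v).card ≤ j) ∧
      (∀ u v, e u < e v → G.Adj u v → e u ∈ P (e v)) ∧
      ∀ S : Finset (Fin n), S.card = j →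
        {v | (P v).card = j ∧ S ⊆ insert v (P v)}.ncard ≤ 2 := by
  classical
  have := D.finite_node
  obtain ⟨r⟩ := D.isTree.connected.nonempty
  have hcard : ∀ x, (D.bag x).card ≤ j + 1 := fun x => by
    have := (D.width_le_iff j).1 hD.1 x
    omega
  have htop : ∀ v : V, ∃ t, v ∈ D.bag t ∧
      ∀ x ∈ {x | v ∈ D.bag x}, D.tree.dist t r ≤ D.tree.dist x r := by
    intro v
    obtain ⟨⟨x, hx⟩⟩ := (D.connected v).nonempty
    obtain ⟨t, ht, hmin⟩ := Set.exists_min_image {x | v ∈ D.bag x} (D.tree.dist · r)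
      (Set.toFinite _) ⟨x, hx⟩
    exact ⟨t, ht, hmin⟩
  choose t ht htmin using htop
  obtain ⟨n, ⟨e₀⟩⟩ := Finite.exists_equiv_fin V
  -- Vertices are sorted by the depth of the topmost node of their subtree; ties are broken
  -- arbitrarily.
  let d : V → ℕ := fun v => D.tree.dist (t v) r
  let σ := Tuple.sort (d ∘ e₀.symm)
  let e : V ≃ Fin n := e₀.trans σ.symm
  have hmono : ∀ a b : Fin n, a ≤ b → d (e.symm a) ≤ d (e.symm b) := fun a b hab =>
    Tuple.monotone_sort (d ∘ e₀.symm) hab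
  have hbag : ∀ a b : Fin n, a ≤ b → ∀ x, e.symm a ∈ D.bag x → e.symm b ∈ D.bag x →
      e.symm a ∈ D.bag (t (e.symm b)) := fun a b hab x ha hb =>
    D.isTree.mem_of_mem_of_dist_le r (D.connected (e.symm a)) (D.connected (e.symm b)) ha hb
      (ht _) (ht _) (htmin _) (htmin _) (hmono a b hab)
  let P : Fin n → Finset (Fin n) := fun v =>
    Finset.univ.filter fun u => u < v ∧ e.symm u ∈ D.bag (t (e.symm v))
  have hmem : ∀ u v, u ∈ P v ↔ u < v ∧ e.symm u ∈ D.bag (t (e.symm v)) := fun u v => by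
    simp [P]
  have hP : IsElimination P :=
    { lt := fun h => ((hmem _ _).1 h).1
      clique := fun {u w v} hu hw huw =>
        (hmem _ _).2 ⟨huw, hbag u w huw.le _ ((hmem _ _).1 hu).2 ((hmem _ _).1 hw).2⟩ }
  have hsub : ∀ v, (insert v (P v)).map e.symm.toEmbedding ⊆ D.bag (t (e.symm v)) := by
    intro v x hx
    obtain ⟨u, hu, rfl⟩ := Finset.mem_map.1 hx
    rcases Finset.mem_insert.1 hu with rfl | hu
    · exact ht _
    · exact ((hmem _ _).1 hu).2
  have hins : ∀ v, (insert v (P v)).card = (P v).card + 1 := fun v =>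
    Finset.card_insert_of_notMem fun h => (hP.lt h).false
  refine ⟨n, e, P, hP, fun v => ?_, fun u v huv hadj => ?_, fun S hS => ?_⟩
  · have h1 := (Finset.card_le_card (hsub v)).trans (hcard _)
    rw [Finset.card_map, hins] at h1
    omega
  · obtain ⟨x, hu, hv⟩ := D.exists_bag_of_adj u v hadj
    refine (hmem _ _).2 ⟨huv, hbag _ _ huv.le x ?_ ?_⟩ <;> simpa
  -- Vertices with `j` smaller neighbours are counted by their top nodes. Such a `v` and `P v` fill
  -- the bag there, so distinct `v` and `w` with the same top would each be smaller than the other.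
  · refine (Set.ncard_le_ncard_of_injOn (fun v => t (e.symm v)) ?_ ?_ (Set.toFinite _)).trans
      (hD.2 (S.map e.symm.toEmbedding) (by rw [Finset.card_map, hS]))
    · rintro v ⟨-, hv⟩
      exact (Finset.map_subset_map.2 hv).trans (hsub v)
    · rintro v ⟨hv, -⟩ w ⟨hw, -⟩ hvw
      have hfull : ∀ v, (P v).card = j →
          (insert v (P v)).map e.symm.toEmbedding = D.bag (t (e.symm v)) := fun v hv =>
        Finset.eq_of_subset_of_card_le (hsub v) (by rw [Finset.card_map, hins, hv]; exact hcard _)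
      have h1 : insert v (P v) = insert w (P w) :=
        Finset.map_injective e.symm.toEmbedding
          ((hfull v hv).trans ((congrArg D.bag hvw).trans (hfull w hw).symm))
      have hv' : v ∈ insert w (P w) := h1 ▸ Finset.mem_insert_self v _
      have hw' : w ∈ insert v (P v) := h1 ▸ Finset.mem_insert_self w _
      rcases Finset.mem_insert.1 hv' with rfl | hv'
      · rfl
      rcases Finset.mem_insert.1 hw' with rfl | hw'
      · rfl
      exact absurd (hP.lt hv') (hP.lt hw').asymm

end SimpleGraph

/-! ### The two factors and the embedding -/

section InArcsDigraph

variable {α : Type} {Q : α → Finset α}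

theorem IsElimination.isOriented [LinearOrder α] (hQ : IsElimination Q) :
    (Digraph.mk fun a b => a ∈ Q b).IsOriented :=
  fun _ _ h h' => (hQ.lt h).asymm (hQ.lt h')

theorem IsElimination.treewidth_le [LinearOrder α] [Finite α] (hQ : IsElimination Q) {w : ℕ}
    (hw : ∀ b, (Q b).card ≤ w) :
    (Digraph.mk fun a b => a ∈ Q b).toSimpleGraphInclusive.treewidth ≤ w :=
  SimpleGraph.treewidth_le_of_isElimination _ hQ
    (fun a b hab (h : _ ∧ (a ∈ Q b ∨ b ∈ Q a)) =>
      h.2.resolve_right fun h' => hab.asymm (hQ.lt h')) hw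

theorem maxIndegree_le_of_card_le [Finite α] {w : ℕ} (hw : ∀ b, (Q b).card ≤ w) :
    (Digraph.mk fun a b => a ∈ Q b).maxIndegree ≤ w := by
  refine ciSup_le' fun b => ?_
  change {x | x ∈ Q b}.ncard ≤ w
  rw [show {x | x ∈ Q b} = (Q b : Set α) from rfl, Set.ncard_coe_finset]
  exact hw b

end InArcsDigraph

theorem ArcLE.directedProduct_adj {α : Type} [LinearOrder α] {P : α → Finset α}
    {f : α → Bool → α} {u v : α} (h : ArcLE P f u v) (hne : f u ≠ f v) :
    ((Digraph.mk fun a b => a ∈ inArcs P f true b).directedProduct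
      (Digraph.mk fun a b => a ∈ inArcs P f false b)).Adj (f u true, f u false)
      (f v true, f v false) := by
  rcases h true with h1 | h1 <;> rcases h false with h2 | h2
  · exact absurd (funext fun i => by cases i <;> assumption) hne
  · exact .inl ⟨h1, h2⟩
  · exact .inr (.inl ⟨h2, h1⟩)
  · exact .inr (.inr ⟨h1, h2⟩)

/-- Underlying undirected graphs of digraphs are given by `Digraph.toSimpleGraphInclusive`: two
distinct vertices are adjacent if there is an arc between them in at least one direction. -/
theorem theorem1p8 {V : Type*} [Finite V] (k : ℕ) (hk : 2 ≤ k) (G : SimpleGraph V)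
    (hG : G.simpleTreewidth ≤ k) :
    ∃ (V₁ V₂ : Type) (_ : Finite V₁) (_ : Finite V₂) (H₁ : Digraph V₁) (H₂ : Digraph V₂),
      H₁.IsOriented ∧ H₂.IsOriented ∧
      H₁.toSimpleGraphInclusive.treewidth ≤ (k : ℤ) - 1 ∧
      H₂.toSimpleGraphInclusive.treewidth ≤ (k : ℤ) - 1 ∧
      H₁.maxIndegree ≤ k - 1 ∧ H₂.maxIndegree ≤ k - 1 ∧
      G.IsContained (H₁.directedProduct H₂).toSimpleGraphInclusive := by
  obtain ⟨D, hD⟩ := G.simpleTreewidth_isLeast.1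
  obtain ⟨n, e, P, hP, hcard, hadj, hsimple⟩ := hD.exists_isElimination
  have hcard' : ∀ v, (P v).card ≤ k := fun v => (hcard v).trans hG
  have hsimple' : ∀ S : Finset (Fin n), S.card = k →
      {v | (P v).card = k ∧ S ⊆ insert v (P v)}.ncard ≤ 2 := by
    intro S hS
    -- If the simple treewidth is below `k`, no `P v` has `k` elements and the condition is vacuous.
    rcases hG.eq_or_lt with h | h
    · rw [h] at hsimple
      exact hsimple S hS
    · rw [show {v | (P v).card = k ∧ S ⊆ insert v (P v)} = ∅ from
        Set.eq_empty_of_forall_notMem fun v hv => ((hcard v).trans_lt h).ne hv.1, Set.ncard_empty]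
      exact Nat.zero_le _
  obtain ⟨f, hf⟩ : ∃ f, ∀ v, ChosenAt k P f v := by
    rcases isEmpty_or_nonempty (Fin n) with h0 | h0
    · exact ⟨fun v => h0.elim v, fun v => h0.elim v⟩
    · exact exists_forall_chosenAt hk hP hcard'
  have hQ i := isElimination_inArcs hP hf i
  have hQcard : ∀ i b, (inArcs P f i b).card ≤ k - 1 := fun i b =>
    Nat.le_sub_one_of_lt (card_inArcs_lt (by omega) hP hf i b)
  have hinj := injective_of_chosenAt hP hcard' hsimple' hf
  have hcast : ((k - 1 : ℕ) : ℤ) = (k : ℤ) - 1 := by omega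
  have hpair : ∀ v, ∀ u ∈ P v,
      ((Digraph.mk fun a b => a ∈ inArcs P f true b).directedProduct
        (Digraph.mk fun a b => a ∈ inArcs P f false b)).toSimpleGraphInclusive.Adj
        (f u true, f u false) (f v true, f v false) := by
    intro v u hu
    have hne : f u ≠ f v := hinj.ne (hP.lt hu).ne
    refine ⟨fun h => hne ?_, ?_⟩
    · rw [Prod.mk.injEq] at h
      exact funext fun i => by cases i <;> simp [h]
    · exact (arcLE_or_arcLE hP hf v u hu).imp (·.directedProduct_adj hne)
        (·.directedProduct_adj hne.symm)
  refine ⟨Fin n, Fin n, inferInstance, inferInstance, _, _, (hQ true).isOriented,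
    (hQ false).isOriented, hcast ▸ (hQ true).treewidth_le (hQcard true),
    hcast ▸ (hQ false).treewidth_le (hQcard false), maxIndegree_le_of_card_le (hQcard true),
    maxIndegree_le_of_card_le (hQcard false), ⟨⟨⟨fun v => (f (e v) true, f (e v) false), ?_⟩, ?_⟩⟩⟩
  · intro u v huv
    rcases lt_trichotomy (e u) (e v) with h | h | h
    · exact hpair _ _ (hadj u v h huv)
    · exact absurd (e.injective h) huv.ne
    · exact (hpair _ _ (hadj v u h huv.symm)).symm
  · intro u v huv
    rw [RelHom.coeFn_mk, Prod.mk.injEq] at huv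
    exact e.injective (hinj (funext fun i => by cases i <;> simp [huv]))
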